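/- An implication algebra is a set with an operation $\to$ and a constant $1$ such that $x\to x=1$, $(x\to y)\to x=x$, $(x\to y)\to y=(y\to x)\to x$ and $x\to(y\to z)=y\to(x\to z)$; it is ordered by $x\le y\iff x\to y=1$, with joins $x\vee y=(x\to y)\to y$. A symmetric implication algebra is an implication algebra with an automorphism $T$ such that $T\circ T=\mathrm{id}$; its morphisms are the maps preserving $\to$ and $T$, and its (partial) caret operation is $x\mathbin{\hat{}}y=x\wedge T(x\to y)$, defined whenever this meet exists. The algebra is locally symmetric if $x\wedge T(x\to y)$ exists whenever $y\le x$. Let $\mathcal A_2\vee\mathcal A_3$ be the variety generated by the two subalgebras $A_2=\{(0,0),(1,1)\}$ and $A_3=\{(0,1),(1,0),(1,1)\}$ of the Boolean algebra $\{0,1\}^2$ with $T(a,b)=(b,a)$. **Theorem.** (1) For every symmetric implication algebra $\mathcal L$ there are a locally symmetric implication algebra $\mathrm{env}(\mathcal L)$ and an injective morphism $e:\mathcal L\to\mathrm{env}(\mathcal L)$ such that (a) the range of $e$ is upwards closed in $\mathrm{env}(\mathcal L)$ and generates $\mathrm{env}(\mathcal L)$ under caret and $\to$; (b) for every morphism $f:\mathcal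 L\to\mathcal M$ to a locally symmetric implication algebra $\mathcal M$ there is a unique morphism $\hat f:\mathrm{env}(\mathcal L)\to\mathcal M$ with $\hat f\circ e=f$. If moreover $\mathcal L$ belongs to $\mathcal A_2\vee\mathcal A_3$, then so does $\mathrm{env}(\mathcal L)$. (2) A cubic implication algebra is a join semilattice with greatest element $1$ and a binary operation $\Delta$ such that: $\Delta(y,x)\vee x=y$ and $\Delta(y,\Delta(y,x))=x$ if $x\le y$; $\Delta(z,\Delta(y,x))=\Delta(\Delta(z,y),\Delta(z,x))$ and $\Delta(z,x)\le\Delta(z,y)$ if $x\le y\le z$; and, writing $xy=\Delta(1,\Delta(x\vee y,y))\vee y$, $(xy)y=x\vee y$ and $x(yz)=y(xz)$. Among all algebras with operations $\to,1,T$, the variety $\mathcal A_2\vee\mathcal A_3$ coincides with the variety generated by all cubic implication algebras (with $x\to y=xy$ and $T(x)=\Delta(1,x)$) and all Boolean algebras (with the usual $\to$ and $T=\mathrm{id}$), and it is exactly the class of symmetric implication algebras satisfying the identity $(x\to T(x))\vee y\vee T(y)=1$. -/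

import Mathlib

universe u v

/-! ## Implication algebras -/

/-- Implication algebras (Abbott). The constant `⊤` is the element `1 = x → x`. -/
class ImplicationAlgebra (α : Type*) [HImp α] [Top α] : Prop where
  himp_self' : ∀ x : α, x ⇨ x = ⊤
  contraction : ∀ x y : α, (x ⇨ y) ⇨ x = x
  quasi_comm : ∀ x y : α, (x ⇨ y) ⇨ y = (y ⇨ x) ⇨ x
  exchange : ∀ x y z : α, x ⇨ (y ⇨ z) = y ⇨ (x ⇨ z)

namespace ImplicationAlgebra

variable {α : Type*} [HImp α] [Top α] [ImplicationAlgebra α]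

theorem top_himp' (x : α) : ⊤ ⇨ x = x := by
  rw [← himp_self' x, contraction]

theorem himp_top' (x : α) : x ⇨ ⊤ = (⊤ : α) := by
  have h := contraction (⊤ : α) x
  rwa [top_himp'] at h

theorem aux_trans {x y z : α} (h₁ : x ⇨ y = ⊤) (h₂ : y ⇨ z = ⊤) : x ⇨ z = ⊤ := by
  have hz : (z ⇨ y) ⇨ y = z := by rw [← quasi_comm, h₂, top_himp']
  rw [← hz, exchange, h₁, himp_top']

theorem aux_antitone {x z : α} (y : α) (h : x ⇨ z = ⊤) : (z ⇨ y) ⇨ (x ⇨ y) = ⊤ := by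
  rw [exchange]
  exact aux_trans h (by rw [exchange, himp_self'])

/-- The natural order of an implication algebra: `x ≤ y` iff `x → y = 1`, with
`x ∨ y = (x → y) → y`. -/
instance toSemilatticeSup : SemilatticeSup α where
  le x y := x ⇨ y = ⊤
  le_refl x := himp_self' x
  le_trans _ _ _ h₁ h₂ := aux_trans h₁ h₂
  le_antisymm x y h₁ h₂ := by
    have h := quasi_comm x y
    rw [show x ⇨ y = ⊤ from h₁, show y ⇨ x = ⊤ from h₂, top_himp', top_himp'] at h
    exact h.symm
  sup x y := (x ⇨ y) ⇨ y
  le_sup_left x y := by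
    rw [exchange, himp_self']
  le_sup_right x y := by
    rw [exchange, himp_self', himp_top']
  sup_le x y z h₁ h₂ := by
    have hz : (z ⇨ y) ⇨ y = z := by
      rw [← quasi_comm, show y ⇨ z = ⊤ from h₂, top_himp']
    have h := aux_antitone y (aux_antitone y (show x ⇨ z = ⊤ from h₁))
    rwa [hz] at h

instance toOrderTop : OrderTop α where
  le_top x := himp_top' x

end ImplicationAlgebra

/-! ## Symmetric implication algebras -/

/-- The operations `→`, `1`, `T` of a symmetric implication algebra, without axioms. -/
class SymSig (α : Type*) extends HImp α, Top α where
  T : α → α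

/-- An implication algebra with a distinguished automorphism `T` such that `T ∘ T = id`. -/
class SymmetricImplicationAlgebra (α : Type*) [SymSig α] : Prop extends ImplicationAlgebra α where
  T_himp : ∀ x y : α, SymSig.T (x ⇨ y) = SymSig.T x ⇨ SymSig.T y
  T_T : ∀ x : α, SymSig.T (SymSig.T x) = x

/-- Morphisms for the operations `→`, `1`, `T`. -/
structure IsSymHom {α : Type*} {β : Type*} [SymSig α] [SymSig β] (f : α → β) : Prop where
  map_himp : ∀ x y, f (x ⇨ y) = f x ⇨ f y
  map_top : f ⊤ = ⊤
  map_T : ∀ x, f (SymSig.T x) = SymSig.T (f x)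

section Caret

variable {α : Type*} [SymSig α] [SymmetricImplicationAlgebra α]

/-- `IsCaret x y z`: the meet `x ∧ T (x → y)`, i.e. the (partial) caret of `x` and `y`, exists
and equals `z`. -/
def IsCaret (x y z : α) : Prop := IsGLB {x, SymSig.T (x ⇨ y)} z

/-- `S` generates the algebra under (all defined) carets and `→`. -/
def GeneratesUnderCaretHimp (S : Set α) : Prop :=
  ∀ R : Set α, S ⊆ R →
    (∀ x ∈ R, ∀ y ∈ R, x ⇨ y ∈ R) →
    (∀ x ∈ R, ∀ y ∈ R, ∀ z, IsCaret x y z → z ∈ R) →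
    R = Set.univ

variable (α) in
/-- Locally symmetric: the meet `x ∧ T (x → y)` exists whenever `y ≤ x`. -/
def IsLocallySymmetric : Prop := ∀ x y : α, y ≤ x → ∃ z, IsCaret x y z

end Caret

/-! ## Cubic implication algebras -/

/-- The derived operation `x y = Δ(1, Δ(x ∨ y, y)) ∨ y`. -/
def cubicProd {α : Type*} [SemilatticeSup α] [OrderTop α] (delta : α → α → α) (x y : α) : α :=
  delta ⊤ (delta (x ⊔ y) y) ⊔ y

/-- Cubic implication algebras: join semilattices with `1 = ⊤` and a binary operation `Δ`. -/
class CubicImplicationAlgebra (α : Type*) extends SemilatticeSup α, OrderTop α where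
  delta : α → α → α
  delta_sup : ∀ x y, x ≤ y → delta y x ⊔ x = y
  delta_delta : ∀ x y z, x ≤ y → y ≤ z →
    delta z (delta y x) = delta (delta z y) (delta z x)
  delta_invol : ∀ x y, x ≤ y → delta y (delta y x) = x
  delta_mono : ∀ x y z, x ≤ y → y ≤ z → delta z x ≤ delta z y
  prod_prod : ∀ x y, cubicProd delta (cubicProd delta x y) y = x ⊔ y
  prod_exchange : ∀ x y z,
    cubicProd delta x (cubicProd delta y z) = cubicProd delta y (cubicProd delta x z)

/-! ## Varieties of algebras with operations `→`, `1`, `T` -/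

/-- Algebras of the similarity type of symmetric implication algebras, no axioms assumed. -/
structure SymSigAlg : Type (u + 1) where
  carrier : Type u
  [sig : SymSig carrier]

namespace SymSigAlg

instance (A : SymSigAlg.{u}) : SymSig A.carrier := A.sig

/-- Product algebras, with coordinatewise operations. -/
def pi {I : Type v} (F : I → SymSigAlg.{u}) : SymSigAlg.{max u v} where
  carrier := ∀ i, (F i).carrier
  sig :=
    { himp := fun x y i => x i ⇨ y i
      top := fun _ => ⊤
      T := fun x i => SymSig.T (x i) }

/-- A cubic implication algebra with `x → y = x y` and `T x = Δ(1, x)`. -/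
def ofCubic (C : Type u) [CubicImplicationAlgebra C] : SymSigAlg.{u} where
  carrier := C
  sig :=
    { himp := cubicProd CubicImplicationAlgebra.delta
      top := ⊤
      T := fun x => CubicImplicationAlgebra.delta ⊤ x }

/-- A Boolean algebra with its usual implication and `T` the identity. -/
def ofBoolean (B : Type u) [BooleanAlgebra B] : SymSigAlg.{u} where
  carrier := B
  sig :=
    { himp := fun x y => xᶜ ⊔ y
      top := ⊤
      T := fun x => x }

/-- `A₂`: the diagonal `{(0,0), (1,1)}` of `2 × 2`, with the twist. -/
def A₂ : SymSigAlg.{0} where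
  carrier := {p : Bool × Bool // p.1 = p.2}
  sig :=
    { himp := fun p q => ⟨(!p.1.1 || q.1.1, !p.1.2 || q.1.2), by rw [p.2, q.2]⟩
      top := ⟨(true, true), rfl⟩
      T := fun p => ⟨(p.1.2, p.1.1), p.2.symm⟩ }

/-- `A₃`: the subalgebra `{(0,1), (1,0), (1,1)}` of `2 × 2`, with the twist. -/
def A₃ : SymSigAlg.{0} where
  carrier := {p : Bool × Bool // (p.1 || p.2) = true}
  sig :=
    { himp := fun p q => ⟨(!p.1.1 || q.1.1, !p.1.2 || q.1.2), by
        obtain ⟨⟨a, b⟩, h⟩ := p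
        obtain ⟨⟨c, d⟩, k⟩ := q
        revert a b c d
        decide⟩
      top := ⟨(true, true), rfl⟩
      T := fun p => ⟨(p.1.2, p.1.1), by rw [Bool.or_comm]; exact p.2⟩ }

/-- Isomorphic algebras, possibly in different universes. -/
def Iso (A : SymSigAlg.{u}) (B : SymSigAlg.{v}) : Prop :=
  ∃ f : A.carrier → B.carrier, IsSymHom f ∧ Function.Bijective f

end SymSigAlg

/-- The variety generated by a class `K` of algebras: the least class that contains `K` and is
closed under products, subalgebras (up to isomorphism) and homomorphic images. -/
inductive GeneratedVariety (K : SymSigAlg.{u} → Prop) : SymSigAlg.{u} → Prop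
  | of (A : SymSigAlg.{u}) : K A → GeneratedVariety K A
  | prod (I : Type u) (F : I → SymSigAlg.{u}) :
      (∀ i, GeneratedVariety K (F i)) → GeneratedVariety K (SymSigAlg.pi F)
  | sub (A B : SymSigAlg.{u}) (f : B.carrier → A.carrier) :
      IsSymHom f → Function.Injective f → GeneratedVariety K A → GeneratedVariety K B
  | image (A B : SymSigAlg.{u}) (f : A.carrier → B.carrier) :
      IsSymHom f → Function.Surjective f → GeneratedVariety K A → GeneratedVariety K B

/-- The class of all cubic implication algebras and all Boolean algebras. -/
inductive IsCubicOrBoolean : SymSigAlg.{u} → Prop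
  | cubic (C : Type u) [CubicImplicationAlgebra C] : IsCubicOrBoolean (SymSigAlg.ofCubic C)
  | boolean (B : Type u) [BooleanAlgebra B] : IsCubicOrBoolean (SymSigAlg.ofBoolean B)

/-- The variety `𝒜₂ ∨ 𝒜₃`, generated by `A₂` and `A₃`. -/
def VarietyA₂A₃ : SymSigAlg.{u} → Prop :=
  GeneratedVariety fun A => A.Iso SymSigAlg.A₂ ∨ A.Iso SymSigAlg.A₃

/-- Symmetric implication algebras in which `(x → T x) ∨ y ∨ T y = 1` holds identically. -/
def SatisfiesA₂A₃Identity (A : SymSigAlg.{u}) : Prop :=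
  ∃ _ : SymmetricImplicationAlgebra A.carrier,
    ∀ x y : A.carrier, (x ⇨ SymSig.T x) ⊔ y ⊔ SymSig.T y = ⊤

set_option linter.unusedSectionVars false

/-! ### Order, self-distributivity and two-valued points -/

namespace ImplicationAlgebra

variable {α : Type*} [HImp α] [Top α] [ImplicationAlgebra α]

/-! Two-valued homomorphisms (points) separate elements (`Point.exists_separating`). An implication
algebra is thus an algebra of sets of points, its existing binary meets are intersections, and
identities become propositional tautologies. `T` acts on points by an involution. In a locally
symmetric algebra, `m ≤ a` has a caret `a ∧ T (a → m)`. Putting `b = a → m` gives `a ∨ b = 1` and `a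
∧ b = m`, so the caret is `a ∧ T b`. The envelope consists of the point sets of this form. They are
closed under `→`, `T` and caret, and a morphism `f` extends by sending `a ∧ T b` to the caret of `f
a` and `f m`. The identity says that each point is either fixed by `T` or contains `y` or `T y` for
every `y`. In these two cases `x ↦ (h x, h (T x))` maps into `A₂` or `A₃`, so an algebra with the
identity embeds in a product of copies of these. Cubic and Boolean algebras satisfy the identity,
`A₃` is cubic, and `A₂` is Boolean. -/

theorem le_iff_himp_eq_top {x y : α} : x ≤ y ↔ x ⇨ y = ⊤ := Iff.rfl

theorem sup_eq_himp (x y : α) : x ⊔ y = (x ⇨ y) ⇨ y := rfl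

theorem le_himp (x y : α) : y ≤ x ⇨ y := by
  rw [le_iff_himp_eq_top, exchange, himp_self', himp_top']

theorem himp_le_himp_right {x z : α} (y : α) (h : x ≤ z) : z ⇨ y ≤ x ⇨ y :=
  aux_antitone y h

theorem himp_le_himp_left {x z : α} (y : α) (h : x ≤ z) : y ⇨ x ≤ y ⇨ z := by
  have hz : (z ⇨ x) ⇨ x = z := by rw [← quasi_comm, le_iff_himp_eq_top.1 h, top_himp']
  rw [← hz, exchange]
  exact le_himp _ _

/-- Self-distributivity of implication, as an inequality. -/
theorem himp_himp_le (a p q : α) : a ⇨ (p ⇨ q) ≤ (a ⇨ p) ⇨ (a ⇨ q) := by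
  have key : ∀ w : α, a ≤ w → (a ⇨ q) ⇨ w ≤ w := fun w hw => by
    have h := himp_le_himp_right w (himp_le_himp_right q hw)
    rwa [contraction] at h
  -- The goal becomes `(a → q) → p ≤ a ∨ p`, to which `key` applies with `w = a ∨ p`.
  rw [exchange a p q, le_iff_himp_eq_top, exchange (p ⇨ (a ⇨ q)), quasi_comm p, exchange (a ⇨ p)]
  exact (himp_le_himp_left _ (le_sup_right : p ≤ a ⊔ p)).trans (key _ le_sup_left)

variable (α) in
/-- Two-valued homomorphisms of an implication algebra. -/
def Point : Type _ := {h : α → Prop // ∀ x y, h (x ⇨ y) ↔ (h x → h y)}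

namespace Point

instance : CoeFun (Point α) fun _ => α → Prop := ⟨Subtype.val⟩

@[ext] theorem ext {h k : Point α} (hk : ∀ x, h x ↔ k x) : h = k :=
  Subtype.ext (funext fun x => propext (hk x))

@[simp] theorem map_himp (h : Point α) (x y : α) : h (x ⇨ y) ↔ (h x → h y) := h.2 x y

@[simp] theorem map_top (h : Point α) : h ⊤ := by
  rw [← himp_self' (⊤ : α), map_himp]
  exact id

@[simp] theorem map_sup (h : Point α) (x y : α) : h (x ⊔ y) ↔ (h x ∨ h y) := by
  rw [sup_eq_himp, map_himp, map_himp]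
  tauto

theorem mono (h : Point α) {x y : α} (hxy : x ≤ y) (hx : h x) : h y := by
  have ht := h.map_top
  rw [← le_iff_himp_eq_top.1 hxy, map_himp] at ht
  exact ht hx

/-- Zorn gives a filter `F` above `x`, maximal among those omitting `y`. If `a ∉ F`, the filter `{z
| a → z ∈ F}` extends `F` and contains `a`, so by maximality it contains `y`. -/
theorem exists_separating {x y : α} (hxy : ¬ x ≤ y) : ∃ h : Point α, h x ∧ ¬ h y := by
  let S : Set (Set α) := {F | (⊤ ∈ F ∧ ∀ p q, p ∈ F → p ⇨ q ∈ F → q ∈ F) ∧ y ∉ F}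
  obtain ⟨F, hxF, hF⟩ := zorn_subset_nonempty S
    (fun c hc hch hne => by
      refine ⟨⋃₀ c, ⟨⟨?_, ?_⟩, ?_⟩, fun s hs => Set.subset_sUnion_of_mem hs⟩
      · obtain ⟨s, hs⟩ := hne
        exact ⟨s, hs, (hc hs).1.1⟩
      · rintro p q ⟨s, hs, hps⟩ ⟨t, ht, hqt⟩
        rcases hch.total hs ht with hst | hts
        · exact ⟨t, ht, (hc ht).1.2 p q (hst hps) hqt⟩
        · exact ⟨s, hs, (hc hs).1.2 p q hps (hts hqt)⟩
      · rintro ⟨s, hs, hys⟩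
        exact (hc hs).2 hys)
    {z | x ≤ z}
    ⟨⟨himp_top' x, fun p q hp hpq => by
      have h := himp_himp_le x p q
      rw [le_iff_himp_eq_top.1 (show x ≤ p ⇨ q from hpq), le_iff_himp_eq_top.1 (show x ≤ p from hp),
        top_himp'] at h
      exact top_le_iff.1 h⟩, hxy⟩
  obtain ⟨⟨htop, hmp⟩, hy⟩ := hF.prop
  have hup : ∀ p q, p ≤ q → p ∈ F → q ∈ F := fun p q hpq hp =>
    hmp p q hp (by rw [le_iff_himp_eq_top.1 hpq]; exact htop)
  have hded : ∀ a, a ∉ F → a ⇨ y ∈ F := fun a ha => by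
    by_contra hay
    have hG : {z | a ⇨ z ∈ F} ∈ S := by
      refine ⟨⟨?_, fun p q hp hpq => ?_⟩, hay⟩
      · rw [Set.mem_ofPred_eq, himp_top']
        exact htop
      · exact hmp _ _ hp (hup _ _ (himp_himp_le a p q) hpq)
    have hFG : F ⊆ {z | a ⇨ z ∈ F} := fun z hz => hup _ _ (le_himp a z) hz
    refine ha (hF.le_of_ge hG hFG ?_)
    rw [Set.mem_ofPred_eq, himp_self']
    exact htop
  refine ⟨⟨(· ∈ F), fun a b => ⟨fun hab ha => hmp a b ha hab, fun hab => ?_⟩⟩,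
    hxF (le_refl x), hy⟩
  by_cases ha : a ∈ F
  · exact hup _ _ (le_himp a b) (hab ha)
  · by_contra hnab
    -- If `a → b ∉ F`, then `(a → b) → y ∈ F`. Under the hypothesis `y → b`, `a → y` yields `a → b`
    -- and hence `y`; so `(y → b) → y`, which is `y`, lies in `F`.
    have h₁ : (y ⇨ b) ⇨ (a ⇨ y) ∈ F := hup _ _ (le_himp _ _) (hded a ha)
    have h₂ : (y ⇨ b) ⇨ (a ⇨ b) ∈ F := by
      rw [exchange]
      exact hup _ _ (himp_le_himp_left a (le_sup_left : y ≤ y ⊔ b)) (hded a ha)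
    have h₃ : (y ⇨ b) ⇨ y ∈ F :=
      hmp _ _ h₂ (hup _ _ ((le_himp (y ⇨ b) _).trans (himp_himp_le _ _ _)) (hded _ hnab))
    rw [contraction] at h₃
    exact hy h₃

theorem le_iff {x y : α} : x ≤ y ↔ ∀ h : Point α, h x → h y := by
  refine ⟨fun hxy h => h.mono hxy, fun hxy => ?_⟩
  by_contra hn
  obtain ⟨h, hx, hy⟩ := exists_separating hn
  exact hy (hxy h hx)

theorem eq_iff {x y : α} : x = y ↔ ∀ h : Point α, h x ↔ h y := by
  refine ⟨fun hxy h => by rw [hxy], fun hxy => le_antisymm ?_ ?_⟩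
  · exact le_iff.2 fun h => (hxy h).1
  · exact le_iff.2 fun h => (hxy h).2

/-- Two elements with a common lower bound have a meet. -/
theorem exists_meet {x y z : α} (hx : z ≤ x) (hy : z ≤ y) :
    ∃ m : α, ∀ h : Point α, h m ↔ h x ∧ h y := by
  -- The interval above `z` is Boolean with least element `z`, and this is `¬(x → ¬y)` there.
  refine ⟨(x ⇨ (y ⇨ z)) ⇨ z, fun h => ?_⟩
  have h₁ := h.mono hx
  have h₂ := h.mono hy
  simp only [map_himp]
  tauto

/-- A greatest lower bound is a common lower bound, so the pointwise meet exists and must equal it.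
-/
theorem isGLB_pair_iff {x y z : α} : IsGLB {x, y} z ↔ ∀ h : Point α, h z ↔ h x ∧ h y := by
  constructor
  · intro hz h
    have hx : z ≤ x := hz.1 (by simp)
    have hy : z ≤ y := hz.1 (by simp)
    obtain ⟨m, hm⟩ := exists_meet hx hy
    have hmz : m ≤ z := hz.2 (by
      rintro w (rfl | rfl)
      · exact le_iff.2 fun k hk => ((hm k).1 hk).1
      · exact le_iff.2 fun k hk => ((hm k).1 hk).2)
    exact ⟨fun hh => ⟨h.mono hx hh, h.mono hy hh⟩, fun hh => h.mono hmz ((hm h).2 hh)⟩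
  · refine fun hz => ⟨?_, fun w hw => le_iff.2 fun h hh => (hz h).2 ⟨?_, ?_⟩⟩
    · rintro w (rfl | rfl)
      · exact le_iff.2 fun k hk => ((hz k).1 hk).1
      · exact le_iff.2 fun k hk => ((hz k).1 hk).2
    · exact h.mono (hw (by simp)) hh
    · exact h.mono (hw (by simp)) hh

end Point

end ImplicationAlgebra

open ImplicationAlgebra

/-! ## Points of symmetric implication algebras -/

section Points

variable {α : Type*} {β : Type*} [SymSig α] [SymmetricImplicationAlgebra α]
  [SymSig β] [SymmetricImplicationAlgebra β]

/-- The action of `T` on points. -/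
def ImplicationAlgebra.Point.conj (h : Point α) : Point α :=
  ⟨fun x => h (SymSig.T x), fun x y =>
    (SymmetricImplicationAlgebra.T_himp x y ▸ h.map_himp (SymSig.T x) (SymSig.T y) :)⟩

@[simp] theorem ImplicationAlgebra.Point.conj_apply (h : Point α) (x : α) :
    h.conj x ↔ h (SymSig.T x) := Iff.rfl

@[simp] theorem ImplicationAlgebra.Point.conj_conj (h : Point α) : h.conj.conj = h := by
  ext x
  simp [SymmetricImplicationAlgebra.T_T]

/-- Pullback of points along a morphism. -/
def ImplicationAlgebra.Point.comap {f : α → β} (hf : IsSymHom f) (k : Point β) : Point α :=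
  ⟨fun x => k (f x), fun x y => (hf.map_himp x y ▸ k.map_himp (f x) (f y) :)⟩

@[simp] theorem ImplicationAlgebra.Point.comap_apply {f : α → β} (hf : IsSymHom f) (k : Point β)
    (x : α) : k.comap hf x ↔ k (f x) := Iff.rfl

theorem ImplicationAlgebra.Point.comap_conj {f : α → β} (hf : IsSymHom f) (k : Point β) :
    k.conj.comap hf = (k.comap hf).conj := by
  ext x
  simp [hf.map_T]

theorem isCaret_iff {x y z : α} :
    IsCaret x y z ↔ ∀ h : Point α, h z ↔ h x ∧ (h.conj x → h.conj y) := by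
  rw [IsCaret, Point.isGLB_pair_iff]
  simp [SymmetricImplicationAlgebra.T_himp]

/-- Carets are determined on points, and points pull back along morphisms. -/
theorem IsSymHom.map_isCaret {f : α → β} (hf : IsSymHom f) {x y z : α} (h : IsCaret x y z) :
    IsCaret (f x) (f y) (f z) := by
  rw [isCaret_iff] at h ⊢
  intro k
  have hk := h (k.comap hf)
  rwa [← Point.comap_conj] at hk

/-- Morphisms that agree on a generating set agree. -/
theorem GeneratesUnderCaretHimp.hom_ext {S : Set α} (hS : GeneratesUnderCaretHimp S)
    {f g : α → β} (hf : IsSymHom f) (hg : IsSymHom g) (hfg : ∀ x ∈ S, f x = g x) : f = g := by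
  have h := hS {x | f x = g x} hfg
    (fun x hx y hy => by
      rw [Set.mem_ofPred_eq] at hx hy ⊢
      rw [hf.map_himp, hg.map_himp, hx, hy])
    (fun x hx y hy z hz => by
      rw [Set.mem_ofPred_eq] at hx hy ⊢
      have h₁ := hf.map_isCaret hz
      rw [hx, hy] at h₁
      exact IsGLB.unique h₁ (hg.map_isCaret hz))
  funext x
  have hx : x ∈ {x | f x = g x} := h ▸ Set.mem_univ x
  exact hx

end Points

/-! ## The enveloping locally symmetric implication algebra -/

section Envelope

variable (L : Type u) [SymSig L] [SymmetricImplicationAlgebra L]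

/-- The sets of points of the form `a ∧ T b`, where `a ∨ b = 1` and `a ∧ b` exists. -/
def Envelope : Type u :=
  {w : Set (Point L) // ∃ a b m : L, (∀ h : Point L, h a ∨ h b) ∧
    (∀ h : Point L, h m ↔ h a ∧ h b) ∧ ∀ h : Point L, h ∈ w ↔ h a ∧ h.conj b}

variable {L}

namespace Envelope

instance : SymSig (Envelope L) where
  himp w v := ⟨{h | h ∈ w.1 → h ∈ v.1}, by
    obtain ⟨w, a, b, -, -, -, hw⟩ := w
    obtain ⟨v, c, d, m, hcd, hm, hv⟩ := v
    -- With `w = a ∧ T b` and `v = c ∧ T d`, `w → v` is `(w → c) ∧ T (T w → d)`. Both `w → c` and `T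
    -- w → d` are nested implications in `L`, and `m` bounds them from below.
    have hc : m ≤ a ⇨ (SymSig.T b ⇨ c) := Point.le_iff.2 fun h hh => by
      simp [(hm h).1 hh]
    have hd : m ≤ SymSig.T a ⇨ (b ⇨ d) := Point.le_iff.2 fun h hh => by
      simp [(hm h).1 hh]
    obtain ⟨n, hn⟩ := Point.exists_meet hc hd
    refine ⟨_, _, n, fun h => ?_, hn, fun h => ?_⟩
    · have := hcd h
      simp only [Point.map_himp]
      tauto
    · simp only [Point.map_himp, Set.mem_ofPred_eq, hw, hv, Point.conj_apply,
        SymmetricImplicationAlgebra.T_himp, SymmetricImplicationAlgebra.T_T]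
      tauto⟩
  top := ⟨Set.univ, ⊤, ⊤, ⊤, by simp, by simp, fun h => by simp [-Point.conj_apply]⟩
  T w := ⟨{h | h.conj ∈ w.1}, by
    obtain ⟨w, a, b, m, hab, hm, hw⟩ := w
    exact ⟨SymSig.T a, SymSig.T b, SymSig.T m, fun h => hab h.conj, fun h => hm h.conj,
      fun h => hw h.conj⟩⟩

@[ext] theorem ext {w v : Envelope L} (h : ∀ p, p ∈ w.1 ↔ p ∈ v.1) : w = v :=
  Subtype.ext (Set.ext h)

@[simp] theorem mem_himp {w v : Envelope L} {h : Point L} :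
    h ∈ (w ⇨ v).1 ↔ (h ∈ w.1 → h ∈ v.1) := Iff.rfl

@[simp] theorem mem_top {h : Point L} : h ∈ (⊤ : Envelope L).1 := Set.mem_univ h

@[simp] theorem mem_T {w : Envelope L} {h : Point L} : h ∈ (SymSig.T w).1 ↔ h.conj ∈ w.1 := Iff.rfl

instance : SymmetricImplicationAlgebra (Envelope L) where
  himp_self' x := by ext; simp
  contraction x y := by ext; simp only [mem_himp]; tauto
  quasi_comm x y := by ext; simp only [mem_himp]; tauto
  exchange x y z := by ext; simp only [mem_himp]; tauto
  T_himp x y := by ext; simp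
  T_T x := by ext; simp

theorem le_iff_mem {w v : Envelope L} : w ≤ v ↔ ∀ h, h ∈ w.1 → h ∈ v.1 := by
  rw [le_iff_himp_eq_top, Envelope.ext_iff]
  simp

@[simp] theorem mem_sup {w v : Envelope L} {h : Point L} :
    h ∈ (w ⊔ v).1 ↔ (h ∈ w.1 ∨ h ∈ v.1) := by
  rw [sup_eq_himp, mem_himp, mem_himp]
  tauto

theorem isCaret_of_mem {x y z : Envelope L}
    (hz : ∀ h, h ∈ z.1 ↔ h ∈ x.1 ∧ (h.conj ∈ x.1 → h.conj ∈ y.1)) : IsCaret x y z := by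
  refine ⟨?_, fun w hw => le_iff_mem.2 fun h hh => (hz h).2 ⟨?_, ?_⟩⟩
  · rintro w (rfl | rfl)
    · exact le_iff_mem.2 fun h hh => ((hz h).1 hh).1
    · exact le_iff_mem.2 fun h hh => ((hz h).1 hh).2
  · exact le_iff_mem.1 (hw (by simp)) h hh
  · exact le_iff_mem.1 (hw (show SymSig.T (x ⇨ y) ∈ _ by simp)) h hh

theorem isLocallySymmetric : IsLocallySymmetric (Envelope L) := by
  intro w v hvw
  rw [le_iff_mem] at hvw
  obtain ⟨a, b, -, -, -, hw⟩ := w.2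
  obtain ⟨c, d, m, hcd, hm, hv⟩ := v.2
  -- `p = w → c` and `q = T w → d` represent the relative complements that are moved by `T`.
  have hp : ∀ h : Point L, h (a ⇨ (SymSig.T b ⇨ c)) ↔ (h ∈ w.1 → h c) := fun h => by
    rw [hw]; simp
  have hq : ∀ h : Point L, h (SymSig.T a ⇨ (b ⇨ d)) ↔ (h.conj ∈ w.1 → h d) := fun h => by
    rw [hw]; simp
  generalize a ⇨ (SymSig.T b ⇨ c) = p at hp
  generalize SymSig.T a ⇨ (b ⇨ d) = q at hq
  have hmc : ∀ h : Point L, h m → h c := fun h hh => ((hm h).1 hh).1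
  have hmd : ∀ h : Point L, h m → h d := fun h hh => ((hm h).1 hh).2
  -- Take `c' = (w ∨ c) ∧ (T w → d)` and `d' = (T w ∨ d) ∧ (w → c)`. Then `c' ∧ T d' = (w ∨ v) ∧ T
  -- (w → v)`, the caret since `v ≤ w`, while `c' ∧ d' = c ∧ d = m`.
  obtain ⟨c', hc'⟩ := Point.exists_meet (x := p ⇨ c) (y := q) (z := m)
    (Point.le_iff.2 fun h hh => (h.map_himp _ _).2 fun _ => hmc h hh)
    (Point.le_iff.2 fun h hh => (hq h).2 fun _ => hmd h hh)
  obtain ⟨d', hd'⟩ := Point.exists_meet (x := q ⇨ d) (y := p) (z := m)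
    (Point.le_iff.2 fun h hh => (h.map_himp _ _).2 fun _ => hmd h hh)
    (Point.le_iff.2 fun h hh => (hp h).2 fun _ => hmc h hh)
  simp only [Point.map_himp, hp, hq] at hc' hd'
  refine ⟨⟨{h | h ∈ w.1 ∧ (h.conj ∈ w.1 → h.conj ∈ v.1)}, c', d', m, ?_, ?_, ?_⟩,
    isCaret_of_mem fun h => Iff.rfl⟩
  · intro h
    have := hcd h
    rw [hc', hd']
    tauto
  · intro h
    rw [hc', hd', hm]
    tauto
  · intro h
    have h₁ := hvw h
    have h₂ := hvw h.conj
    have h₃ := hcd h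
    have h₄ := hcd h.conj
    rw [hv] at h₁ h₂
    rw [hc', hd', Set.mem_ofPred_eq, hv, Point.conj_conj] at *
    tauto

/-- The embedding of a symmetric implication algebra into its envelope. -/
def of (x : L) : Envelope L :=
  ⟨{h | h x}, x, ⊤, x, fun h => by simp, fun h => by simp, fun h => by simp [-Point.conj_apply]⟩

@[simp] theorem mem_of {x : L} {h : Point L} : h ∈ (of x).1 ↔ h x := Iff.rfl

theorem isSymHom_of : IsSymHom (of : L → Envelope L) where
  map_himp x y := by ext; simp
  map_top := by ext; simp
  map_T x := by ext; simp

theorem of_injective : Function.Injective (of : L → Envelope L) := fun x y hxy =>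
  Point.eq_iff.2 fun h => by rw [← mem_of, hxy, mem_of]

theorem isUpperSet_range_of : IsUpperSet (Set.range (of : L → Envelope L)) := by
  rintro _ w hw ⟨x, rfl⟩
  rw [le_iff_mem] at hw
  obtain ⟨a, b, -, -, -, hab⟩ := w.2
  -- This is `(w → x) → x = w ∨ x = w`, computed inside `L`.
  refine ⟨(a ⇨ (SymSig.T b ⇨ x)) ⇨ x, ?_⟩
  ext h
  have := hw h
  simp only [mem_of, Point.map_himp, hab, Point.conj_apply] at *
  tauto

theorem generates_range_of : GeneratesUnderCaretHimp (Set.range (of : L → Envelope L)) := by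
  intro R hR _ hcaret
  refine Set.eq_univ_of_forall fun w => ?_
  obtain ⟨a, b, m, hab, hm, hw⟩ := w.2
  -- Since `a ∨ b = 1`, `a → m = b`, so `a ∧ T b` is the caret of `a` and `m`.
  refine hcaret (of a) (hR ⟨a, rfl⟩) (of m) (hR ⟨m, rfl⟩) w (isCaret_of_mem fun h => ?_)
  have := hab h.conj
  simp only [mem_of, hm, hw]
  tauto

/-- The image of `a ∧ T b` is the caret of `f a` and `f m`. Its points are those whose pullback lies
in `w`, so it does not depend on `a` and `b`, and the morphism laws hold pointwise. -/
theorem exists_lift {M : Type v} [SymSig M] [SymmetricImplicationAlgebra M]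
    (hM : IsLocallySymmetric M) {f : L → M} (hf : IsSymHom f) :
    ∃ g : Envelope L → M, IsSymHom g ∧ g ∘ of = f := by
  have key : ∀ w : Envelope L, ∃ z : M, ∀ k : Point M, k z ↔ k.comap hf ∈ w.1 := by
    intro w
    obtain ⟨a, b, m, hab, hm, hw⟩ := w.2
    obtain ⟨z, hz⟩ := hM (f a) (f m)
      (Point.le_iff.2 fun k hk => ((hm (k.comap hf)).1 hk).1)
    refine ⟨z, fun k => ?_⟩
    have h₁ := hm (k.comap hf).conj
    have h₂ := hab (k.comap hf).conj
    rw [hw, isCaret_iff.1 hz k, ← Point.comap_conj] at *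
    simp only [Point.comap_apply] at *
    tauto
  choose g hg using key
  refine ⟨g, ⟨fun x y => ?_, ?_, fun x => ?_⟩, funext fun x => ?_⟩
  · exact Point.eq_iff.2 fun k => by simp [hg]
  · exact Point.eq_iff.2 fun k => by simp [hg]
  · refine Point.eq_iff.2 fun k => ?_
    rw [hg, mem_T, ← Point.comap_conj, ← hg, Point.conj_apply]
  · exact Point.eq_iff.2 fun k => by simp [hg]

theorem existsUnique_lift {M : Type v} [SymSig M] [SymmetricImplicationAlgebra M]
    (hM : IsLocallySymmetric M) {f : L → M} (hf : IsSymHom f) :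
    ∃! g : Envelope L → M, IsSymHom g ∧ g ∘ of = f := by
  obtain ⟨g, hg, hgf⟩ := exists_lift hM hf
  refine ⟨g, ⟨hg, hgf⟩, fun g' ⟨hg', hgf'⟩ => generates_range_of.hom_ext hg' hg ?_⟩
  rintro _ ⟨x, rfl⟩
  exact congrFun (hgf'.trans hgf.symm) x

end Envelope

end Envelope

/-! ## The identity of `𝒜₂ ∨ 𝒜₃` -/

section Identity

variable {L : Type u} [SymSig L] [SymmetricImplicationAlgebra L]

/-- The identity says that every point is fixed by `T` or contains `y` or `T y` for each `y`. -/
theorem forall_sup_eq_top_iff :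
    (∀ x y : L, (x ⇨ SymSig.T x) ⊔ y ⊔ SymSig.T y = ⊤) ↔
      ∀ h : Point L, (∀ x, h x ↔ h (SymSig.T x)) ∨ ∀ y, h y ∨ h (SymSig.T y) := by
  constructor
  · intro hL h
    refine or_iff_not_imp_right.2 fun hn => ?_
    push Not at hn
    obtain ⟨y, hy, hTy⟩ := hn
    have key : ∀ x, h x → h (SymSig.T x) := fun x hx => by
      have ht := h.map_top
      rw [← hL x y] at ht
      simp only [Point.map_sup, Point.map_himp] at ht
      tauto
    refine fun x => ⟨key x, fun hx => ?_⟩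
    rw [← SymmetricImplicationAlgebra.T_T x]
    exact key _ hx
  · intro hL x y
    refine Point.eq_iff.2 fun h => ?_
    simp only [Point.map_sup, Point.map_himp, Point.map_top, iff_true]
    rcases hL h with hh | hh
    · exact Or.inl (Or.inl (hh x).1)
    · have := hh y
      tauto

/-- Envelope elements are sets of points of `L`, so the dichotomy for those points suffices. In its
second case, `h` or its conjugate contains `m = a ∧ b`, and `a ∨ b = 1` at the other one puts `h` in
`y` or `T y`. -/
theorem Envelope.sup_eq_top (hL : ∀ x y : L, (x ⇨ SymSig.T x) ⊔ y ⊔ SymSig.T y = ⊤)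
    (x y : Envelope L) : (x ⇨ SymSig.T x) ⊔ y ⊔ SymSig.T y = ⊤ := by
  ext h
  simp only [mem_sup, mem_himp, mem_T, mem_top, iff_true]
  rcases forall_sup_eq_top_iff.1 hL h with hh | hh
  · have hc : h.conj = h := Point.ext fun x => (hh x).symm
    rw [hc]
    exact Or.inl (Or.inl id)
  · obtain ⟨a, b, m, hab, hm, hw⟩ := y.2
    have h₁ := hh m
    have h₂ := hab h
    have h₃ := hab h.conj
    rw [← Point.conj_apply, hm, hm] at h₁
    rw [hw, hw, Point.conj_conj]
    tauto

end Identity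

/-! ## Varieties -/

theorem GeneratedVariety.mono {K K' : SymSigAlg.{u} → Prop}
    (hK : ∀ A, K A → GeneratedVariety K' A) {A : SymSigAlg.{u}} (hA : GeneratedVariety K A) :
    GeneratedVariety K' A := by
  induction hA with
  | of A h => exact hK A h
  | prod I F _ ih => exact .prod I F ih
  | sub A B f hf hi _ ih => exact .sub A B f hf hi ih
  | image A B f hf hs _ ih => exact .image A B f hf hs ih

/-- The equational description of `SatisfiesA₂A₃Identity`. -/
theorem satisfiesA₂A₃Identity_iff {A : SymSigAlg.{u}} :
    SatisfiesA₂A₃Identity A ↔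
      ((∀ x : A.carrier, x ⇨ x = ⊤) ∧ (∀ x y : A.carrier, (x ⇨ y) ⇨ x = x) ∧
      (∀ x y : A.carrier, (x ⇨ y) ⇨ y = (y ⇨ x) ⇨ x) ∧
      (∀ x y z : A.carrier, x ⇨ (y ⇨ z) = y ⇨ (x ⇨ z)) ∧
      (∀ x y : A.carrier, SymSig.T (x ⇨ y) = SymSig.T x ⇨ SymSig.T y) ∧
      (∀ x : A.carrier, SymSig.T (SymSig.T x) = x) ∧
      ∀ x y : A.carrier, ((((x ⇨ SymSig.T x) ⇨ y) ⇨ y) ⇨ SymSig.T y) ⇨ SymSig.T y = ⊤) :=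
  ⟨fun ⟨_, h⟩ => ⟨himp_self', contraction, quasi_comm, exchange,
    SymmetricImplicationAlgebra.T_himp, SymmetricImplicationAlgebra.T_T, h⟩,
  fun ⟨h₁, h₂, h₃, h₄, h₅, h₆, h⟩ =>
    ⟨{ himp_self' := h₁, contraction := h₂, quasi_comm := h₃, exchange := h₄,
       T_himp := h₅, T_T := h₆ }, h⟩⟩

theorem SatisfiesA₂A₃Identity.of_injective {A : SymSigAlg.{u}} {B : SymSigAlg.{v}}
    {f : B.carrier → A.carrier} (hf : IsSymHom f) (hi : Function.Injective f)
    (hA : SatisfiesA₂A₃Identity A) : SatisfiesA₂A₃Identity B := by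
  rw [satisfiesA₂A₃Identity_iff] at hA ⊢
  obtain ⟨h₁, h₂, h₃, h₄, h₅, h₆, h₇⟩ := hA
  refine ⟨fun x => hi ?_, fun x y => hi ?_, fun x y => hi ?_, fun x y z => hi ?_,
    fun x y => hi ?_, fun x => hi ?_, fun x y => hi ?_⟩ <;>
    simp only [hf.map_himp, hf.map_top, hf.map_T]
  exacts [h₁ _, h₂ _ _, h₃ _ _, h₄ _ _ _, h₅ _ _, h₆ _, h₇ _ _]

theorem SatisfiesA₂A₃Identity.of_surjective {A : SymSigAlg.{u}} {B : SymSigAlg.{v}}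
    {f : A.carrier → B.carrier} (hf : IsSymHom f) (hs : Function.Surjective f)
    (hA : SatisfiesA₂A₃Identity A) : SatisfiesA₂A₃Identity B := by
  rw [satisfiesA₂A₃Identity_iff] at hA ⊢
  obtain ⟨h₁, h₂, h₃, h₄, h₅, h₆, h₇⟩ := hA
  simp only [hs.forall, ← hf.map_himp, ← hf.map_top, ← hf.map_T]
  exact ⟨fun _ => congrArg f (h₁ _), fun _ _ => congrArg f (h₂ _ _),
    fun _ _ => congrArg f (h₃ _ _), fun _ _ _ => congrArg f (h₄ _ _ _),
    fun _ _ => congrArg f (h₅ _ _), fun _ => congrArg f (h₆ _), fun _ _ => congrArg f (h₇ _ _)⟩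

theorem SatisfiesA₂A₃Identity.pi {I : Type v} {F : I → SymSigAlg.{u}}
    (hF : ∀ i, SatisfiesA₂A₃Identity (F i)) : SatisfiesA₂A₃Identity (SymSigAlg.pi F) := by
  simp only [satisfiesA₂A₃Identity_iff] at hF ⊢
  exact ⟨fun _ => funext fun i => (hF i).1 _, fun _ _ => funext fun i => (hF i).2.1 _ _,
    fun _ _ => funext fun i => (hF i).2.2.1 _ _,
    fun _ _ _ => funext fun i => (hF i).2.2.2.1 _ _ _,
    fun _ _ => funext fun i => (hF i).2.2.2.2.1 _ _,
    fun _ => funext fun i => (hF i).2.2.2.2.2.1 _,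
    fun _ _ => funext fun i => (hF i).2.2.2.2.2.2 _ _⟩

theorem GeneratedVariety.satisfiesA₂A₃Identity {K : SymSigAlg.{u} → Prop}
    (hK : ∀ A, K A → SatisfiesA₂A₃Identity A) {A : SymSigAlg.{u}} (hA : GeneratedVariety K A) :
    SatisfiesA₂A₃Identity A := by
  induction hA with
  | of A h => exact hK A h
  | prod I F _ ih => exact .pi ih
  | sub A B f hf hi _ ih => exact .of_injective hf hi ih
  | image A B f hf hs _ ih => exact .of_surjective hf hs ih

theorem satisfiesA₂A₃Identity_A₂ : SatisfiesA₂A₃Identity SymSigAlg.A₂ := by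
  rw [satisfiesA₂A₃Identity_iff]
  refine ⟨?_, ?_, ?_, ?_, ?_, ?_, ?_⟩ <;> unfold SymSigAlg.A₂ <;> decide

theorem satisfiesA₂A₃Identity_A₃ : SatisfiesA₂A₃Identity SymSigAlg.A₃ := by
  rw [satisfiesA₂A₃Identity_iff]
  refine ⟨?_, ?_, ?_, ?_, ?_, ?_, ?_⟩ <;> unfold SymSigAlg.A₃ <;> decide

theorem VarietyA₂A₃.satisfiesA₂A₃Identity {A : SymSigAlg.{u}} (hA : VarietyA₂A₃ A) :
    SatisfiesA₂A₃Identity A := by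
  refine GeneratedVariety.satisfiesA₂A₃Identity ?_ hA
  rintro A (⟨f, hf, hb⟩ | ⟨f, hf, hb⟩)
  · exact .of_injective hf hb.1 satisfiesA₂A₃Identity_A₂
  · exact .of_injective hf hb.1 satisfiesA₂A₃Identity_A₃

namespace SymSigAlg

/-- Universe lift of an algebra. -/
def lift (A : SymSigAlg.{v}) : SymSigAlg.{max u v} where
  carrier := ULift.{u} A.carrier
  sig :=
    { himp := fun x y => ⟨x.down ⇨ y.down⟩
      top := ⟨⊤⟩
      T := fun x => ⟨SymSig.T x.down⟩ }

theorem lift_iso (A : SymSigAlg.{v}) : (lift.{u} A).Iso A :=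
  ⟨ULift.down, ⟨fun _ _ => rfl, rfl, fun _ => rfl⟩, ULift.down_bijective⟩

end SymSigAlg

/-- Each point of an algebra satisfying the identity is induced by a morphism to `A₂` or `A₃`. -/
theorem exists_hom_of_point {L : Type u} [SymSig L] [SymmetricImplicationAlgebra L]
    (h : Point L) (hh : (∀ x, h x ↔ h (SymSig.T x)) ∨ ∀ y, h y ∨ h (SymSig.T y)) :
    ∃ (B : SymSigAlg.{u}) (g : L → B.carrier),
      VarietyA₂A₃ B ∧ IsSymHom g ∧ ∀ x y, g x = g y → (h x ↔ h y) := by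
  classical
  rcases hh with hh | hh
  -- Both cases use `x ↦ (h x, h (T x))`; the hypothesis puts the image on the diagonal or away from
  -- `(0,0)`.
  · refine ⟨SymSigAlg.lift SymSigAlg.A₂,
      fun x => ULift.up ⟨(decide (h x), decide (h (SymSig.T x))), by simp [← hh]⟩,
      .of _ (Or.inl (SymSigAlg.lift_iso _)), ⟨fun x y => ?_, ?_, fun x => ?_⟩, fun x y hxy => ?_⟩
    · refine congrArg ULift.up (Subtype.ext (Prod.ext ?_ ?_))
      · change decide (h (x ⇨ y)) = (!decide (h x) || decide (h y))
        simp [imp_iff_not_or]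
      · change decide (h (SymSig.T (x ⇨ y))) =
          (!decide (h (SymSig.T x)) || decide (h (SymSig.T y)))
        simp [SymmetricImplicationAlgebra.T_himp, imp_iff_not_or]
    · refine congrArg ULift.up (Subtype.ext (Prod.ext ?_ ?_))
      · exact decide_eq_true h.map_top
      · exact decide_eq_true h.conj.map_top
    · refine congrArg ULift.up (Subtype.ext (Prod.ext rfl ?_))
      change decide (h (SymSig.T (SymSig.T x))) = decide (h x)
      rw [SymmetricImplicationAlgebra.T_T]
    · exact decide_eq_decide.1 (congrArg (fun z => z.down.1.1) hxy)
  · refine ⟨SymSigAlg.lift SymSigAlg.A₃,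
      fun x => ULift.up ⟨(decide (h x), decide (h (SymSig.T x))), by simpa using hh x⟩,
      .of _ (Or.inr (SymSigAlg.lift_iso _)), ⟨fun x y => ?_, ?_, fun x => ?_⟩, fun x y hxy => ?_⟩
    · refine congrArg ULift.up (Subtype.ext (Prod.ext ?_ ?_))
      · change decide (h (x ⇨ y)) = (!decide (h x) || decide (h y))
        simp [imp_iff_not_or]
      · change decide (h (SymSig.T (x ⇨ y))) =
          (!decide (h (SymSig.T x)) || decide (h (SymSig.T y)))
        simp [SymmetricImplicationAlgebra.T_himp, imp_iff_not_or]
    · refine congrArg ULift.up (Subtype.ext (Prod.ext ?_ ?_))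
      · exact decide_eq_true h.map_top
      · exact decide_eq_true h.conj.map_top
    · refine congrArg ULift.up (Subtype.ext (Prod.ext rfl ?_))
      change decide (h (SymSig.T (SymSig.T x))) = decide (h x)
      rw [SymmetricImplicationAlgebra.T_T]
    · exact decide_eq_decide.1 (congrArg (fun z => z.down.1.1) hxy)

/-- Points separate, so the algebra embeds in a product of copies of `A₂` and `A₃` indexed by its
points. -/
theorem SatisfiesA₂A₃Identity.varietyA₂A₃ {A : SymSigAlg.{u}} (hA : SatisfiesA₂A₃Identity A) :
    VarietyA₂A₃ A := by
  obtain ⟨_, hA⟩ := hA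
  have hpt := fun h : Point A.carrier => exists_hom_of_point h (forall_sup_eq_top_iff.1 hA h)
  choose F g hF hg hinj using hpt
  refine .sub (SymSigAlg.pi F) A (fun x h => g h x) ⟨fun x y => ?_, ?_, fun x => ?_⟩
    (fun x y hxy => ?_) (.prod _ F hF)
  · exact funext fun h => (hg h).map_himp x y
  · exact funext fun h => (hg h).map_top
  · exact funext fun h => (hg h).map_T x
  · exact Point.eq_iff.2 fun h => hinj h x y (congrFun hxy h)

/-! ## Cubic implication algebras and Boolean algebras -/

section Cubic

open CubicImplicationAlgebra

variable {C : Type*} [CubicImplicationAlgebra C]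

theorem delta_le {x y : C} (h : x ≤ y) : delta y x ≤ y := by
  conv_rhs => rw [← delta_sup x y h]
  exact le_sup_left

theorem delta_self (x : C) : delta x x = x := by
  refine le_antisymm (delta_le le_rfl) ?_
  have h := delta_mono (delta x x) x x (delta_le le_rfl) le_rfl
  rwa [delta_invol x x le_rfl] at h

theorem delta_top_delta_top (x : C) : delta ⊤ (delta ⊤ x) = x := delta_invol x ⊤ le_top

theorem delta_top_sup (x y : C) : delta ⊤ (x ⊔ y) = delta ⊤ x ⊔ delta ⊤ y := by
  have mono : ∀ {x y : C}, x ≤ y → delta ⊤ x ≤ delta ⊤ y := fun h => delta_mono _ _ _ h le_top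
  refine le_antisymm ?_ (sup_le (mono le_sup_left) (mono le_sup_right))
  rw [← delta_top_delta_top (delta ⊤ x ⊔ delta ⊤ y)]
  refine mono (sup_le ?_ ?_)
  · conv_lhs => rw [← delta_top_delta_top x]
    exact mono le_sup_left
  · conv_lhs => rw [← delta_top_delta_top y]
    exact mono le_sup_right

theorem cubicProd_of_le {x y : C} (h : x ≤ y) : cubicProd delta x y = ⊤ := by
  rw [cubicProd, sup_eq_right.2 h, delta_self, delta_sup _ _ le_top]

/-- For `u = Δ(x ∨ y, y) ≤ x ∨ y`, the left side is `Δ(1, u) ∨ y ∨ x`, which is above `Δ(1, u) ∨ u =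
1`. -/
theorem cubicProd_sup_left (x y : C) : cubicProd delta x y ⊔ x = ⊤ := by
  refine top_le_iff.1 ?_
  rw [← delta_sup (delta (x ⊔ y) y) ⊤ le_top, cubicProd, sup_assoc]
  exact sup_le_sup_left ((delta_le le_sup_right).trans_eq (sup_comm _ _)) _

theorem cubicProd_contraction (x y : C) : cubicProd delta (cubicProd delta x y) x = x := by
  rw [cubicProd, cubicProd_sup_left, delta_top_delta_top, sup_idem]

theorem delta_top_cubicProd (x y : C) :
    delta ⊤ (cubicProd delta x y) = cubicProd delta (delta ⊤ x) (delta ⊤ y) := by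
  rw [cubicProd, delta_top_sup, delta_delta y (x ⊔ y) ⊤ le_sup_right le_top, delta_top_sup,
    cubicProd]

theorem satisfiesA₂A₃Identity_ofCubic (C : Type u) [CubicImplicationAlgebra C] :
    SatisfiesA₂A₃Identity (SymSigAlg.ofCubic C) := by
  rw [satisfiesA₂A₃Identity_iff]
  refine ⟨fun x => cubicProd_of_le (C := C) le_rfl, cubicProd_contraction (C := C),
    fun x y => ?_, prod_exchange (α := C), delta_top_cubicProd (C := C),
    delta_top_delta_top (C := C), fun x y => ?_⟩
  · exact (prod_prod (α := C) x y).trans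
      ((sup_comm (α := C) x y).trans (prod_prod (α := C) y x).symm)
  · change C at x y
    change cubicProd delta (cubicProd delta (cubicProd delta (cubicProd delta
      (cubicProd delta x (delta ⊤ x)) y) y) (delta ⊤ y)) (delta ⊤ y) = ⊤
    -- Already `y ∨ Δ(1, y) = 1`, whatever `x` is.
    rw [prod_prod, prod_prod, sup_assoc, sup_comm y, delta_sup y ⊤ le_top, sup_top_eq]

end Cubic

theorem satisfiesA₂A₃Identity_ofBoolean (B : Type u) [BooleanAlgebra B] :
    SatisfiesA₂A₃Identity (SymSigAlg.ofBoolean B) := by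
  rw [satisfiesA₂A₃Identity_iff]
  refine ⟨fun x => compl_sup_eq_top (α := B), fun x y => ?_, fun x y => ?_,
    fun x y z => sup_left_comm (α := B) _ _ _, fun x y => rfl, fun x => rfl, fun x y => ?_⟩ <;>
    change B at x y
  · change (xᶜ ⊔ y)ᶜ ⊔ x = x
    simp
  · change (xᶜ ⊔ y)ᶜ ⊔ y = (yᶜ ⊔ x)ᶜ ⊔ x
    simp only [compl_sup, compl_compl, sup_inf_right, compl_sup_eq_top, inf_top_eq]
    exact sup_comm x y
  · change ((((xᶜ ⊔ x)ᶜ ⊔ y)ᶜ ⊔ y)ᶜ ⊔ y)ᶜ ⊔ y = ⊤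
    simp

/-- The algebra `A₃` as a cubic implication algebra. -/
noncomputable instance : CubicImplicationAlgebra {p : Bool × Bool // (p.1 || p.2) = true} where
  toSemilatticeSup := Subtype.semilatticeSup (by decide)
  top := ⟨⊤, rfl⟩
  le_top := by decide
  -- Below a `y ≠ 1` there is only `y` itself, so reflection is trivial there; values with `x ≰ y`
  -- are immaterial.
  delta y x := if y.1 = ⊤ then ⟨x.1.swap, by rw [Bool.or_comm]; exact x.2⟩ else x
  delta_sup := by decide
  delta_delta := by decide
  delta_invol := by decide
  delta_mono := by decide
  prod_prod := by decide
  prod_exchange := by decide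

instance {C : Type*} [CubicImplicationAlgebra C] : CubicImplicationAlgebra (ULift.{u} C) where
  top := ⟨⊤⟩
  le_top x := le_top (a := x.down)
  delta y x := ⟨CubicImplicationAlgebra.delta y.down x.down⟩
  delta_sup x y h := congrArg ULift.up (CubicImplicationAlgebra.delta_sup x.down y.down h)
  delta_delta x y z h k :=
    congrArg ULift.up (CubicImplicationAlgebra.delta_delta x.down y.down z.down h k)
  delta_invol x y h := congrArg ULift.up (CubicImplicationAlgebra.delta_invol x.down y.down h)
  delta_mono x y z h k := CubicImplicationAlgebra.delta_mono x.down y.down z.down h k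
  prod_prod x y := congrArg ULift.up (CubicImplicationAlgebra.prod_prod x.down y.down)
  prod_exchange x y z :=
    congrArg ULift.up (CubicImplicationAlgebra.prod_exchange x.down y.down z.down)

theorem SymSigAlg.A₃_himp_eq_cubicProd : ∀ x y : {p : Bool × Bool // (p.1 || p.2) = true},
    (show SymSigAlg.A₃.carrier from x) ⇨ (show SymSigAlg.A₃.carrier from y) =
      cubicProd CubicImplicationAlgebra.delta x y := by
  unfold SymSigAlg.A₃
  decide

theorem SymSigAlg.A₃_T_eq_delta : ∀ x : {p : Bool × Bool // (p.1 || p.2) = true},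
    SymSig.T (show SymSigAlg.A₃.carrier from x) = CubicImplicationAlgebra.delta ⊤ x := by
  unfold SymSigAlg.A₃
  decide

/-! ### Comparison of the generated varieties and the theorem -/

theorem GeneratedVariety.varietyA₂A₃ {A : SymSigAlg.{u}}
    (hA : GeneratedVariety IsCubicOrBoolean A) : VarietyA₂A₃ A := by
  refine (hA.satisfiesA₂A₃Identity ?_).varietyA₂A₃
  rintro _ (C | B)
  · exact satisfiesA₂A₃Identity_ofCubic C
  · exact satisfiesA₂A₃Identity_ofBoolean B

theorem mainTheorem4 :
    (∀ (L : Type u) [SymSig L] [SymmetricImplicationAlgebra L],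
      ∃ (E : Type u) (_ : SymSig E) (_ : SymmetricImplicationAlgebra E) (e : L → E),
        IsLocallySymmetric E ∧
        IsSymHom e ∧ Function.Injective e ∧
        (VarietyA₂A₃ (SymSigAlg.mk L) → VarietyA₂A₃ (SymSigAlg.mk E)) ∧
        IsUpperSet (Set.range e) ∧
        GeneratesUnderCaretHimp (Set.range e) ∧
        ∀ (M : Type v) [SymSig M] [SymmetricImplicationAlgebra M], IsLocallySymmetric M →
          ∀ f : L → M, IsSymHom f →
            ∃! g : E → M, IsSymHom g ∧ g ∘ e = f) ∧
    (∀ A : SymSigAlg.{u},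
      (GeneratedVariety IsCubicOrBoolean A ↔ VarietyA₂A₃ A) ∧
      (VarietyA₂A₃ A ↔ SatisfiesA₂A₃Identity A)) := by
  refine ⟨fun L _ _ => ⟨Envelope L, inferInstance, inferInstance, Envelope.of,
    Envelope.isLocallySymmetric, Envelope.isSymHom_of, Envelope.of_injective, fun hL => ?_,
    Envelope.isUpperSet_range_of, Envelope.generates_range_of,
    fun M _ _ hM f hf => Envelope.existsUnique_lift hM hf⟩,
    fun A => ⟨⟨fun hA => hA.varietyA₂A₃, fun hA => ?_⟩,
      fun hA => hA.satisfiesA₂A₃Identity, fun hA => hA.varietyA₂A₃⟩⟩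
  · obtain ⟨_, h⟩ := VarietyA₂A₃.satisfiesA₂A₃Identity hL
    exact SatisfiesA₂A₃Identity.varietyA₂A₃ ⟨inferInstance, Envelope.sup_eq_top h⟩
  · refine GeneratedVariety.mono ?_ hA
    rintro A (⟨f, hf, hb⟩ | ⟨f, hf, hb⟩)
    -- On the diagonal one coordinate suffices; the one-point power of `Bool` puts the two-element
    -- Boolean algebra in universe `u`.
    · refine .sub _ _ (fun x => fun _ => (f x).1.1) ⟨fun x y => ?_, ?_, fun x => ?_⟩
        (fun x y hxy => hb.1 ?_) (.of _ (.boolean (PUnit.{u + 1} → Bool)))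
      · simp only [hf.map_himp]
        rfl
      · simp only [hf.map_top]
        rfl
      · simp only [hf.map_T]
        exact funext fun _ => (f x).2.symm
      · have h : (f x).1.1 = (f y).1.1 := congrFun hxy PUnit.unit
        exact Subtype.ext (Prod.ext h ((f x).2.symm.trans (h.trans (f y).2)))
    · refine .sub _ _ (fun x => ULift.up (f x)) ⟨fun x y => ?_, ?_, fun x => ?_⟩
        (fun x y hxy => hb.1 (ULift.up_injective hxy))
        (.of _ (.cubic (ULift.{u} {p : Bool × Bool // (p.1 || p.2) = true})))
      · rw [hf.map_himp]
        exact congrArg ULift.up (SymSigAlg.A₃_himp_eq_cubicProd _ _)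
      · rw [hf.map_top]
        rfl
      · rw [hf.map_T]
        exact congrArg ULift.up (SymSigAlg.A₃_T_eq_delta _)
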